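/- Let $d,m,N\ge 0$ be integers, let all spaces $\mathbb{R}^k$ carry the norm $\|\cdot\|_\infty$ and linear maps the corresponding operator norms. Let $U\subset(\mathbb{R}^d)^{N+1}$ be an open set containing $0$ and let $Z:U\to\mathbb{R}^d$ satisfy $Z(0,\dots,0)=0$ and be differentiable at $0$. Put $B_i=\partial_iZ(0,\dots,0)$ (the partial derivative in the $i$-th block of variables), $T(x)=\sum_{i=0}^N x^iB_i$ and $\mathcal F(x)=\det T(x)$, and assume that $B_0$ is invertible. A vector $v\in\mathbb{R}^d\setminus\{0\}$ with $T(x)v=0$ is called an eigenvector for $x$. Let $\boldsymbol\lambda=(\lambda_1,\dots,\lambda_m)\in\mathbb{R}^m$ be stable, i.e. $|\lambda_i|<1$ for all $i$, and a non-resonant vector of eigenvalues, i.e. for all multi-indices $\alpha\in\mathbb{Z}_{\ge0}^m$, $\mathcal F(\boldsymbol\lambda^\alpha)=0$ if $|\alpha|=1$ and $\mathcal F(\boldsymbol\lambda^\alpha)\ne0$ if $|\alpha|>1$. Let $\Lambda=\mathrm{diag}(\lambda_1,\dots,\lambda_m)$. Call an integer $r\ge 0$ admissible if there is a real $\mu$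 with $$\|\Lambda\|^r\le\mu<1\qquad\text{and}\qquad\sum_{i=1}^N\mu^i\,\|B_0^{-1}B_i\|<1 .$$ Then all sufficiently large $r$ are admissible, and there exist eigenvectors $v_1,\dots,v_m\in\mathbb{R}^d$ for $\lambda_1,\dots,\lambda_m$. Moreover, if $r$ is admissible and $Z$ is $C^{r+1}$ on $U$, then for every choice of eigenvectors $v_i$ for $\lambda_i$ ($i=1,\dots,m$) there are $\rho>0$ and a $C^r$ map $P:\{z\in\mathbb{R}^m:\|z\|_\infty<\rho\}\to\mathbb{R}^d$ such that $P(0)=0$, such that for all $\|z\|_\infty<\rho$ $$\bigl(P(z),P(\Lambda z),\dots,P(\Lambda^Nz)\bigr)\in U,\qquad Z\bigl(P(z),P(\Lambda z),\dots,P(\Lambda^Nz)\bigr)=0,$$ and such that $P'(0)=(v_1\ \cdots\ v_m)$; in particular the range of $P'(0)$ is the space spanned by the eigenvectors $v_1,\dots,v_m$. -/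

import Mathlib

noncomputable section

namespace DifferenceEquation

variable {d m N : ℕ}

/-- The function `Z(θ₀, …, θ_N)` of a difference equation of order `N` in `ℝ^d`. All the spaces
`ℝ^k` carry the uniform norm. -/
abbrev EqFun (d N : ℕ) : Type := (Fin (N + 1) → Fin d → ℝ) → (Fin d → ℝ)

/-- `B_i = ∂_i Z(0, …, 0)`, the partial derivative in the `i`-th block of variables. -/
def B (Z : EqFun d N) (i : Fin (N + 1)) : (Fin d → ℝ) →L[ℝ] (Fin d → ℝ) :=
  (fderiv ℝ Z 0).comp (ContinuousLinearMap.single ℝ (fun _ : Fin (N + 1) => Fin d → ℝ) i)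

/-- `T(x) = ∑_{i=0}^N x^i B_i`. -/
def T (Z : EqFun d N) (x : ℝ) : (Fin d → ℝ) →L[ℝ] (Fin d → ℝ) :=
  ∑ i : Fin (N + 1), x ^ (i : ℕ) • B Z i

/-- The characteristic polynomial `F(x) = det (∑_{i=0}^N x^i B_i)` of the fixed point `0`. -/
def charPoly (Z : EqFun d N) (x : ℝ) : ℝ := (T Z x).det

/-- `v` is an eigenvector of the fixed point `0` for `x`. -/
def IsEigenvector (Z : EqFun d N) (x : ℝ) (v : Fin d → ℝ) : Prop :=
  v ≠ 0 ∧ T Z x v = 0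

/-- `lam` is a stable vector. -/
def IsStable (lam : Fin m → ℝ) : Prop := ∀ i, |lam i| < 1

/-- `lam` is a non-resonant vector of eigenvalues: for every multi-index `α`, the number `lam ^ α`
is a root of the characteristic polynomial if `|α| = 1` and is not a root if `|α| > 1`. -/
def IsNonResonant (Z : EqFun d N) (lam : Fin m → ℝ) : Prop :=
  ∀ α : Fin m → ℕ,
    (∑ i, α i = 1 → charPoly Z (∏ i, lam i ^ α i) = 0) ∧
    (1 < ∑ i, α i → charPoly Z (∏ i, lam i ^ α i) ≠ 0)

/-- The linear map `Λ = diag(lam_1, …, lam_m)` of `ℝ^m`. -/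
def diagMap (lam : Fin m → ℝ) : (Fin m → ℝ) →L[ℝ] (Fin m → ℝ) :=
  LinearMap.toContinuousLinearMap (Matrix.toLin' (Matrix.diagonal lam))

/-- The order of differentiability `r` is large enough: for some `μ`,
`‖Λ‖ ^ r ≤ μ < 1` and `∑_{i=1}^N μ ^ i ‖B₀⁻¹ B_i‖ < 1`. The norms are operator norms. -/
def IsLargeOrder (Z : EqFun d N) (lam : Fin m → ℝ) (r : ℕ) : Prop :=
  ∃ μ : ℝ, ‖diagMap lam‖ ^ r ≤ μ ∧ μ < 1 ∧
    ∑ i : Fin N, μ ^ ((i : ℕ) + 1) * ‖(B Z 0).inverse.comp (B Z i.succ)‖ < 1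

/-- The point `(P(z), P(Λ z), …, P(Λ^N z))`. -/
def orbitTuple (N : ℕ) (lam : Fin m → ℝ) (P : (Fin m → ℝ) → (Fin d → ℝ)) (z : Fin m → ℝ) :
    Fin (N + 1) → Fin d → ℝ :=
  fun j => P ((diagMap lam ^ (j : ℕ)) z)

end DifferenceEquation

end

open DifferenceEquation

/-! Put `L i = -B₀⁻¹ B_{i+1}` and `g = B₀⁻¹ (DZ(0) - Z)`. Then `Z = 0` along the orbit of `P`
becomes the fixed point equation `P z = ∑ L i (P (Λ^{i+1} z)) + g (P z, …, P (Λ^N z))`, where `g`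
vanishes to first order at `0`.

The jet of `P` is found degree by degree (`exists_contDiff_jet`). The eigenvectors solve degree 1.
In degree `n ≥ 2` the coefficient of a monomial `z^α` is acted on by `B₀⁻¹ T(λ^α)`, which is
invertible by non-resonance.

From such a `P₀`, the equation is iterated (`exists_contDiffOn_eq_step`). The increments have
vanishing `r`-jets, so on a small ball their derivatives of order `r` control all lower ones. On
these the linear part contracts by `∑ ‖Λ‖^{r(i+1)} ‖L i‖ < 1`, which is what admissibility of `r`
provides. The nonlinear part adds an arbitrarily small `ε`: Hadamard's lemma gives `g b - g a = H
(a, b) (b - a)` with `H` of class `C^r` and `H (0, 0) = 0`. This is where the extra derivative of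
`Z` is spent. The increments then sum geometrically in `C^r`. -/

open Set Filter Topology

/-! ### Calculus of higher derivatives -/

section Analysis

/-- A parametric integral of a jointly `C^n` function is `C^n`. -/
theorem contDiff_parametric_intervalIntegral {X V : Type} [NormedAddCommGroup X] [NormedSpace ℝ X]
    [FiniteDimensional ℝ X] [NormedAddCommGroup V] [NormedSpace ℝ V] [CompleteSpace V] (n : ℕ)
    {f : X × ℝ → V} (hf : ContDiff ℝ n f) :
    ContDiff ℝ n (fun x => ∫ t in (0 : ℝ)..1, f (x, t)) := by
  induction n generalizing V with
  | zero =>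
    have hc : Continuous f := hf.continuous
    simp only [CharP.cast_eq_zero, contDiff_zero]
    exact intervalIntegral.continuous_parametric_intervalIntegral_of_continuous' (by fun_prop) 0 1
  | succ n ih =>
    have hc : Continuous f := hf.continuous
    have hd : Differentiable ℝ f := hf.differentiable (by simp)
    -- The derivative of the integral is again a parametric integral, with values in another space;
    -- hence the induction over all `V`.
    have hf' : ContDiff ℝ n (fun p : X × ℝ =>
        (fderiv ℝ f p).comp (ContinuousLinearMap.inl ℝ X ℝ)) :=
      (hf.fderiv_right (m := n) (by norm_cast)).clm_comp contDiff_const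
    have hc' := hf'.continuous
    refine contDiff_succ_iff_hasFDerivAt.2 ⟨_, ih hf', fun x => ?_⟩
    obtain ⟨C, hC⟩ := ((isCompact_closedBall x 1).prod
      (isCompact_Icc (a := (0 : ℝ)) (b := 1))).exists_bound_of_continuousOn hc'.continuousOn
    have : ProperSpace X := FiniteDimensional.proper ℝ X
    refine intervalIntegral.hasFDerivAt_integral_of_dominated_of_fderiv_le
      (F := fun x t => f (x, t)) (bound := fun _ => C)
      (F' := fun x t => (fderiv ℝ f (x, t)).comp (ContinuousLinearMap.inl ℝ X ℝ))
      (Metric.closedBall_mem_nhds x one_pos) ?_ ?_ ?_ ?_ ?_ ?_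
    · exact .of_forall fun y => (hc.comp (by fun_prop : Continuous fun t : ℝ => (y, t))).aestronglyMeasurable
    · exact (hc.comp (by fun_prop : Continuous fun t : ℝ => (x, t))).intervalIntegrable _ _
    · exact (hc'.comp (by fun_prop : Continuous fun t : ℝ => (x, t))).aestronglyMeasurable
    · refine .of_forall fun t ht y hy => hC (y, t) ⟨hy, ?_⟩
      rw [uIoc_of_le zero_le_one] at ht
      exact Ioc_subset_Icc_self ht
    · exact intervalIntegrable_const
    · refine .of_forall fun t _ y _ => ?_
      exact (hd (y, t)).hasFDerivAt.comp y (hasFDerivAt_prodMk_left y t)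

/-- Hadamard's lemma: increments of a `C^{r+1}` map depend linearly on the increment of the
variable, through a `C^r` family of linear maps. -/
theorem exists_contDiff_increment {X V : Type} [NormedAddCommGroup X] [NormedSpace ℝ X]
    [FiniteDimensional ℝ X] [NormedAddCommGroup V] [NormedSpace ℝ V] [CompleteSpace V] {r : ℕ}
    {g : X → V} (hg : ContDiff ℝ (r + 1 : ℕ) g) :
    ∃ H : X × X → X →L[ℝ] V, ContDiff ℝ r H ∧ (∀ x, H (x, x) = fderiv ℝ g x) ∧
      ∀ a b, g b - g a = H (a, b) (b - a) := by
  have hd : Differentiable ℝ g := hg.differentiable (by simp)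
  have hg' : ContDiff ℝ r (fderiv ℝ g) := hg.fderiv_right (by norm_cast)
  refine ⟨fun p => ∫ t in (0 : ℝ)..1, fderiv ℝ g (p.1 + t • (p.2 - p.1)), ?_, ?_, ?_⟩
  · refine contDiff_parametric_intervalIntegral r
      (f := fun q : (X × X) × ℝ => fderiv ℝ g (q.1.1 + q.2 • (q.1.2 - q.1.1))) ?_
    exact hg'.comp (by fun_prop)
  · intro x
    simp
  · intro a b
    have hc : Continuous fun t : ℝ => fderiv ℝ g (a + t • (b - a)) :=
      hg'.continuous.comp (by fun_prop)
    have h := intervalIntegral.integral_eq_sub_of_hasDerivAt (a := 0) (b := 1)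
      (f := fun t : ℝ => g (a + t • (b - a)))
      (f' := fun t : ℝ => fderiv ℝ g (a + t • (b - a)) (b - a)) (fun t _ => by
        have h1 : HasDerivAt (fun t : ℝ => a + t • (b - a)) (b - a) t := by
          simpa using ((hasDerivAt_id t).smul_const (b - a)).const_add a
        exact (hd _).hasFDerivAt.comp_hasDerivAt t h1)
      ((hc.clm_apply continuous_const).intervalIntegrable _ _)
    simp only [one_smul, add_sub_cancel, zero_smul, add_zero] at h
    rw [← h, ContinuousLinearMap.intervalIntegral_apply (hc.intervalIntegrable _ _)]

/-- The sum of a series of `C^n` functions is `C^n` on an open preconnected set if the derivatives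
up to order `n` have summable bounds there. -/
theorem contDiffOn_tsum_of_isPreconnected {E F : Type*} [NormedAddCommGroup E] [NormedSpace ℝ E]
    [NormedAddCommGroup F] [NormedSpace ℝ F] [CompleteSpace F] {n : ℕ} {f : ℕ → E → F} {s : Set E}
    (hs : IsOpen s) (hs' : IsPreconnected s) (hf : ∀ i, ContDiff ℝ n (f i)) {u : ℕ → ℝ}
    (hu : Summable u) (hb : ∀ k ≤ n, ∀ i, ∀ x ∈ s, ‖iteratedFDeriv ℝ k (f i) x‖ ≤ u i) :
    ContDiffOn ℝ n (fun x => ∑' i, f i x) s := by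
  have hsum : ∀ k ≤ n, ∀ x ∈ s, Summable fun i => iteratedFDeriv ℝ k (f i) x := fun k hk x hx =>
    .of_norm_bounded hu fun i => hb k hk i x hx
  have key : HasFTaylorSeriesUpToOn n (fun x => ∑' i, f i x)
      (fun x k => ∑' i, iteratedFDeriv ℝ k (f i) x) s := by
    refine ⟨fun x hx => ?_, fun k hk x hx => ?_, fun k hk => ?_⟩
    · change continuousMultilinearCurryFin0 ℝ E F _ = _
      exact (continuousMultilinearCurryFin0 ℝ E F).toContinuousLinearEquiv.map_tsum
    · have hk' : k < n := by exact_mod_cast hk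
      have h := hasFDerivAt_tsum_of_isPreconnected hu hs hs'
        (f := fun i => iteratedFDeriv ℝ k (f i))
        (f' := fun i x => fderiv ℝ (iteratedFDeriv ℝ k (f i)) x)
        (fun i y _ => ((hf i).differentiable_iteratedFDeriv hk y).hasFDerivAt)
        (fun i y hy => by
          rw [norm_fderiv_iteratedFDeriv]
          exact hb (k + 1) hk' i y hy) hx (hsum k hk'.le x hx) hx
      refine h.hasFDerivWithinAt.congr_fderiv (Eq.symm ?_)
      exact (continuousMultilinearCurryLeftEquiv ℝ
        (fun _ : Fin (k + 1) => E) F).toContinuousLinearEquiv.map_tsum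
        (f := fun i => iteratedFDeriv ℝ (k + 1) (f i) x)
    · have hk' : k ≤ n := by exact_mod_cast hk
      exact continuousOn_tsum (fun i => ((hf i).continuous_iteratedFDeriv hk).continuousOn) hu
        fun i x hx => hb k hk' i x hx
  exact key.contDiffOn

theorem exists_norm_iteratedFDeriv_le_of_isCompact {E F : Type*} [NormedAddCommGroup E]
    [NormedSpace ℝ E] [NormedAddCommGroup F] [NormedSpace ℝ F] {r : ℕ} {f : E → F}
    (hf : ContDiff ℝ r f) {s : Set E} (hs : IsCompact s) :
    ∃ M : ℝ, 0 ≤ M ∧ ∀ k ≤ r, ∀ z ∈ s, ‖iteratedFDeriv ℝ k f z‖ ≤ M := by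
  have hc : ContinuousOn (fun z => ∑ k ∈ Finset.range (r + 1), ‖iteratedFDeriv ℝ k f z‖) s :=
    continuousOn_finsetSum _ fun k hk =>
      (hf.continuous_iteratedFDeriv (by
        rw [Finset.mem_range] at hk
        norm_cast
        omega)).norm.continuousOn
  obtain ⟨M, hM⟩ := hs.exists_bound_of_continuousOn hc
  refine ⟨max M 0, le_max_right _ _, fun k hk z hz => le_trans ?_ (le_max_left _ _)⟩
  refine le_trans ?_ ((le_abs_self _).trans (hM z hz))
  exact Finset.single_le_sum (f := fun k => ‖iteratedFDeriv ℝ k f z‖)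
    (fun _ _ => norm_nonneg _) (by simp; omega)

/-- If the derivatives of order less than `r` vanish at `0` then they are controlled on a ball by
the derivative of order `r`. -/
theorem norm_iteratedFDeriv_le_of_vanish {E F : Type*} [NormedAddCommGroup E] [NormedSpace ℝ E]
    [NormedAddCommGroup F] [NormedSpace ℝ F] {r : ℕ} {f : E → F} (hf : ContDiff ℝ r f)
    (h0 : ∀ k < r, iteratedFDeriv ℝ k f 0 = 0) {ρ S : ℝ}
    (hS : ∀ z ∈ Metric.ball (0 : E) ρ, ‖iteratedFDeriv ℝ r f z‖ ≤ S) (j : ℕ) (hj : j ≤ r) :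
    ∀ z ∈ Metric.ball (0 : E) ρ, ‖iteratedFDeriv ℝ (r - j) f z‖ ≤ S * ρ ^ j := by
  induction j with
  | zero => simpa using hS
  | succ j ih =>
    intro z hz
    have hρ : 0 < ρ := Metric.pos_of_mem_ball hz
    have hk : r - j = r - (j + 1) + 1 := by omega
    -- Lowering the order by one is a mean value estimate from `0`, at the cost of a factor `ρ`.
    have h := (convex_ball (0 : E) ρ).norm_image_sub_le_of_norm_fderiv_le (𝕜 := ℝ)
      (f := iteratedFDeriv ℝ (r - (j + 1)) f) (C := S * ρ ^ j)
      (fun y _ => hf.differentiable_iteratedFDeriv (by norm_cast; omega) y)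
      (fun y hy => by
        rw [norm_fderiv_iteratedFDeriv, ← hk]
        exact ih (by omega) y hy) (Metric.mem_ball_self hρ) hz
    rw [h0 _ (by omega), sub_zero, sub_zero] at h
    have hz' : ‖z‖ ≤ ρ := by simpa using (mem_ball_zero_iff.1 hz).le
    have hS0 : 0 ≤ S * ρ ^ j := (norm_nonneg _).trans (ih (by omega) z hz)
    calc _ ≤ _ := h
      _ ≤ S * ρ ^ j * ρ := by gcongr
      _ = S * ρ ^ (j + 1) := by ring

/-- The iterated derivatives of a `C^n` map are symmetric. -/
theorem iteratedFDeriv_comp_perm_of_contDiff {E F : Type*} [NormedAddCommGroup E] [NormedSpace ℝ E]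
    [NormedAddCommGroup F] [NormedSpace ℝ F] {n : ℕ} {f : E → F} (hf : ContDiff ℝ n f) (x : E)
    (v : Fin n → E) (σ : Equiv.Perm (Fin n)) :
    iteratedFDeriv ℝ n f x (v ∘ σ) = iteratedFDeriv ℝ n f x v := by
  induction n generalizing x with
  | zero => rw [Subsingleton.elim (v ∘ σ) v]
  | succ n ih =>
    -- Adjacent transpositions suffice. Those fixing slot `0` follow by induction; the swap of slots
    -- `0` and `1` is the symmetry of a second derivative, with the other arguments frozen.
    have hσ : σ ∈ Submonoid.closure (range fun i : Fin n => Equiv.swap i.castSucc i.succ) := by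
      rw [Equiv.Perm.mclosure_swap_castSucc_succ]
      trivial
    have hfn : ContDiff ℝ n f := hf.of_le (by norm_cast; omega)
    have hd : Differentiable ℝ (iteratedFDeriv ℝ n f) :=
      hf.differentiable_iteratedFDeriv (by norm_cast; omega)
    induction hσ using Submonoid.closure_induction generalizing v with
    | one => rfl
    | mul σ τ _ _ hσ hτ =>
      rw [Equiv.Perm.coe_mul, ← Function.comp_assoc, hτ, hσ]
    | mem σ hσ =>
      obtain ⟨i, rfl⟩ := hσ
      cases n with
      | zero => exact i.elim0
      | succ n =>
        refine Fin.cases ?_ (fun j => ?_) i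
        · have hd0 : Differentiable ℝ (iteratedFDeriv ℝ n f) :=
            hf.differentiable_iteratedFDeriv (by norm_cast; omega)
          set φ : E → F := fun y => iteratedFDeriv ℝ n f y (Fin.tail (Fin.tail v)) with hφ
          have hφ2 : ContDiff ℝ 2 φ := by
            have h1 : ContDiff ℝ 2 (iteratedFDeriv ℝ n f) :=
              hf.iteratedFDeriv_right (by norm_cast; omega)
            exact (ContinuousMultilinearMap.apply ℝ (fun _ : Fin n => E) F
              (Fin.tail (Fin.tail v))).contDiff.comp h1
          have hφ' : Differentiable ℝ (fderiv ℝ φ) :=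
            (hφ2.fderiv_right (m := 1) (by norm_num)).differentiable (by norm_num)
          have key : ∀ w : Fin (n + 2) → E, Fin.tail (Fin.tail w) = Fin.tail (Fin.tail v) →
              iteratedFDeriv ℝ (n + 2) f x w = fderiv ℝ (fderiv ℝ φ) x (w 0) (w 1) := by
            intro w hw
            rw [(hd x).iteratedFDeriv_succ_apply_left']
            have : (fun y => iteratedFDeriv ℝ (n + 1) f y (Fin.tail w)) =
                fun y => fderiv ℝ φ y (w 1) := by
              funext y
              rw [(hd0 y).iteratedFDeriv_succ_apply_left', hw]
              rfl
            rw [this, fderiv_clm_apply (hφ' x) (differentiableAt_const _)]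
            simp
          rw [key v rfl, key]
          · have hs := (hφ2.contDiffAt (x := x)).isSymmSndFDerivAt (by simp)
            rw [hs.eq]
            simp
          · funext k
            simp only [Fin.tail, Function.comp_apply]
            rw [Equiv.swap_apply_of_ne_of_ne]
            · simp [Fin.ext_iff]
            · simp [Fin.ext_iff]
        · rw [(hd x).iteratedFDeriv_succ_apply_left', (hd x).iteratedFDeriv_succ_apply_left']
          have h1 : (v ∘ Equiv.swap j.succ.castSucc j.succ.succ) 0 = v 0 := by
            simp only [Function.comp_apply]
            rw [Equiv.swap_apply_of_ne_of_ne]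
            · simp [Fin.ext_iff]
            · simp [Fin.ext_iff]
          have h2 : Fin.tail (v ∘ Equiv.swap j.succ.castSucc j.succ.succ) =
              Fin.tail v ∘ Equiv.swap j.castSucc j.succ := by
            funext k
            simp only [Fin.tail, Function.comp_apply, Fin.castSucc_succ]
            rw [(Fin.succ_injective _).map_swap]
          simp only [h1, h2, ih hfn]

end Analysis

/-! ### Composition with a map without linear part -/

namespace DifferenceEquation

section Composition

variable {E X V : Type} [NormedAddCommGroup E] [NormedSpace ℝ E] [NormedAddCommGroup X]
  [NormedSpace ℝ X] [FiniteDimensional ℝ X] [NormedAddCommGroup V] [NormedSpace ℝ V]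
  [CompleteSpace V]

/-- If two maps agree to order `n - 1` at `0` and `g` has no linear part, then the compositions
with `g` agree to order `n`. -/
theorem iteratedFDeriv_comp_sub_comp_eq_zero {g : X → V} {r n : ℕ} (hn : n ≤ r)
    (hg : ContDiff ℝ (r + 1 : ℕ) g) (hg' : fderiv ℝ g 0 = 0) {a b : E → X} (ha : ContDiff ℝ r a)
    (hb : ContDiff ℝ r b) (ha0 : a 0 = 0) (hb0 : b 0 = 0)
    (hab : ∀ k < n, iteratedFDeriv ℝ k (fun z => b z - a z) 0 = 0) {k : ℕ} (hk : k ≤ n) :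
    iteratedFDeriv ℝ k (fun z => g (b z) - g (a z)) 0 = 0 := by
  obtain ⟨H, hH, hHd, hHs⟩ := exists_contDiff_increment hg
  simp only [hHs]
  have hHab : ContDiff ℝ r (fun z => H (a z, b z)) := hH.comp (ha.prodMk hb)
  have h := norm_iteratedFDeriv_clm_apply (n := k) hHab (hb.sub ha) 0 (by norm_cast; omega)
  refine norm_le_zero_iff.1 (h.trans (Finset.sum_nonpos fun i hi => ?_))
  -- The Leibniz factor from `b - a` vanishes unless `i = 0` and `k = n`; there the other factor is
  -- `H (0, 0) = g'(0) = 0`.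
  by_cases hkn : k - i < n
  · simp [hab _ hkn]
  · obtain rfl : i = 0 := by
      rw [Finset.mem_range] at hi
      by_contra
      omega
    simp [ha0, hb0, hHd, hg']

/-- Composition with a map without linear part is a contraction on small balls, for maps that agree
to order `r - 1` at `0`, in terms of the derivatives of order `r`. -/
theorem exists_norm_iteratedFDeriv_comp_sub_comp_le {g : X → V} {r : ℕ} (hr : 1 ≤ r)
    (hg : ContDiff ℝ (r + 1 : ℕ) g) (hg' : fderiv ℝ g 0 = 0) {K ε : ℝ} (hK : 1 ≤ K) (hε : 0 < ε) :
    ∃ ρ₀ : ℝ, 0 < ρ₀ ∧ ρ₀ ≤ 1 ∧ ∀ ρ ≤ ρ₀, ∀ a b : E → X, ContDiff ℝ r a → ContDiff ℝ r b →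
      a 0 = 0 → b 0 = 0 →
      (∀ k ≤ r, ∀ z ∈ Metric.ball (0 : E) ρ, ‖iteratedFDeriv ℝ k a z‖ ≤ K) →
      (∀ k ≤ r, ∀ z ∈ Metric.ball (0 : E) ρ, ‖iteratedFDeriv ℝ k b z‖ ≤ K) →
      (∀ k < r, iteratedFDeriv ℝ k (fun z => b z - a z) 0 = 0) → ∀ S : ℝ,
      (∀ z ∈ Metric.ball (0 : E) ρ, ‖iteratedFDeriv ℝ r (fun z => b z - a z) z‖ ≤ S) →
      ∀ z ∈ Metric.ball (0 : E) ρ,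
        ‖iteratedFDeriv ℝ r (fun z => g (b z) - g (a z)) z‖ ≤ ε * S := by
  obtain ⟨H, hH, hHd, hHs⟩ := exists_contDiff_increment hg
  have : ProperSpace X := FiniteDimensional.proper ℝ X
  obtain ⟨M₀, hM₀0, hM₀⟩ := exists_norm_iteratedFDeriv_le_of_isCompact hH
    (isCompact_closedBall (0 : X × X) K)
  -- Faà di Bruno bound for the derivatives of `H (a z, b z)`, uniform in `a`, `b` and `ρ`.
  set M : ℝ := r.factorial * M₀ * K ^ r with hM
  have hM0 : 0 ≤ M := by positivity
  have hH0 : ∀ᶠ w in 𝓝 (0 : X × X), ‖H w‖ < ε / 2 := by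
    have h0 : H 0 = 0 := (hHd 0).trans hg'
    have := (hH.continuous.norm.tendsto (0 : X × X))
    rw [h0, norm_zero] at this
    exact this.eventually_lt_const (by positivity)
  obtain ⟨τ, hτ, hHτ⟩ := Metric.eventually_nhds_iff_ball.1 hH0
  -- The second entry makes `‖H (a z, b z)‖ ≤ ε / 2`; the third makes the Leibniz terms that
  -- differentiate `H` add up to at most `ε / 2 * S`.
  refine ⟨min 1 (min (τ / K) (ε / (2 * (2 ^ r * M + 1)))), by positivity, min_le_left _ _, ?_⟩
  intro ρ hρ a b ha hb ha0 hb0 hKa hKb hab S hS z hz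
  have hρ0 : 0 < ρ := Metric.pos_of_mem_ball hz
  have hρ1 : ρ ≤ 1 := hρ.trans (min_le_left _ _)
  have hρτ : K * ρ ≤ τ := by
    have := hρ.trans ((min_le_right _ _).trans (min_le_left _ _))
    rwa [le_div_iff₀' (by positivity)] at this
  have hρM : 2 ^ r * M * ρ ≤ ε / 2 := by
    have h1 := hρ.trans ((min_le_right _ _).trans (min_le_right _ _))
    rw [le_div_iff₀ (by positivity)] at h1
    nlinarith
  have hS0 : 0 ≤ S := (norm_nonneg _).trans (hS z hz)
  have hlip : ∀ c : E → X, ContDiff ℝ r c → c 0 = 0 →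
      (∀ k ≤ r, ∀ z ∈ Metric.ball (0 : E) ρ, ‖iteratedFDeriv ℝ k c z‖ ≤ K) → ‖c z‖ < K * ρ := by
    intro c hc hc0 hKc
    have h := (convex_ball (0 : E) ρ).norm_image_sub_le_of_norm_fderiv_le (𝕜 := ℝ) (f := c)
      (C := K) (fun y _ => hc.differentiable (by norm_cast; omega) y)
      (fun y hy => by
        rw [← norm_iteratedFDeriv_one]
        exact hKc 1 hr y hy) (Metric.mem_ball_self hρ0) hz
    rw [hc0, sub_zero, sub_zero] at h
    have := mem_ball_zero_iff.1 hz
    exact h.trans_lt (by gcongr)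
  have hz_lt : ‖(a z, b z)‖ < K * ρ := max_lt (hlip a ha ha0 hKa) (hlip b hb hb0 hKb)
  have hHz : ‖H (a z, b z)‖ ≤ ε / 2 :=
    (hHτ _ (mem_ball_zero_iff.2 (hz_lt.trans_le hρτ))).le
  have hzK : (a z, b z) ∈ Metric.closedBall (0 : X × X) K := by
    rw [mem_closedBall_zero_iff]
    exact hz_lt.le.trans (mul_le_of_le_one_right (by positivity) hρ1)
  have hHab : ContDiff ℝ r (fun z => H (a z, b z)) := hH.comp (ha.prodMk hb)
  have hHbound : ∀ k ≤ r, ‖iteratedFDeriv ℝ k (fun z => H (a z, b z)) z‖ ≤ M := by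
    intro k hk
    have h := norm_iteratedFDeriv_comp_le (n := k) (C := M₀) (D := K) hH (ha.prodMk hb)
      (by exact_mod_cast hk) z
      (fun i hi => hM₀ i (hi.trans hk) _ hzK)
      (fun i hi hik => by
        rw [iteratedFDeriv_prodMk ha.contDiffAt hb.contDiffAt (by norm_cast; omega)]
        rw [ContinuousMultilinearMap.opNorm_prod]
        exact (max_le (hKa i (by omega) z hz) (hKb i (by omega) z hz)).trans
          (le_self_pow₀ hK (by omega)))
    refine h.trans ?_
    rw [hM]
    gcongr
  simp only [hHs]
  have h := norm_iteratedFDeriv_clm_apply (n := r) hHab (hb.sub ha) z le_rfl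
  refine h.trans ?_
  -- For `i = 0` the factor `H` is small; for `i ≥ 1` the derivative of `b - a` has order below `r`
  -- and gains a power of `ρ`.
  rw [Finset.sum_range_succ']
  have hfirst : ((r.choose 0 : ℕ) : ℝ) * ‖iteratedFDeriv ℝ 0 (fun z => H (a z, b z)) z‖ *
      ‖iteratedFDeriv ℝ (r - 0) (fun z => b z - a z) z‖ ≤ ε / 2 * S := by
    simp only [Nat.choose_zero_right, Nat.cast_one, one_mul, norm_iteratedFDeriv_zero, Nat.sub_zero]
    gcongr
    exact hS z hz
  have hrest : ∀ i ∈ Finset.range r, ((r.choose (i + 1) : ℕ) : ℝ) *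
      ‖iteratedFDeriv ℝ (i + 1) (fun z => H (a z, b z)) z‖ *
      ‖iteratedFDeriv ℝ (r - (i + 1)) (fun z => b z - a z) z‖ ≤
        (r.choose (i + 1) : ℝ) * (M * (S * ρ)) := by
    intro i hi
    rw [Finset.mem_range] at hi
    rw [mul_assoc]
    have h1 := norm_iteratedFDeriv_le_of_vanish (hb.sub ha) hab hS (i + 1) hi z hz
    have h2 : S * ρ ^ (i + 1) ≤ S * ρ := by
      gcongr
      exact pow_le_of_le_one hρ0.le hρ1 (by omega)
    gcongr
    · exact hHbound _ hi
    · exact h1.trans h2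
  have hchoose : ∑ i ∈ Finset.range r, (r.choose (i + 1) : ℝ) ≤ 2 ^ r := by
    have h1 := Nat.sum_range_choose r
    rw [Finset.sum_range_succ'] at h1
    have h2 : ∑ i ∈ Finset.range r, r.choose (i + 1) ≤ 2 ^ r := by omega
    exact_mod_cast h2
  calc _ ≤ ∑ i ∈ Finset.range r, (r.choose (i + 1) : ℝ) * (M * (S * ρ)) + ε / 2 * S :=
        add_le_add (Finset.sum_le_sum hrest) hfirst
    _ ≤ 2 ^ r * (M * (S * ρ)) + ε / 2 * S := by
        rw [← Finset.sum_mul]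
        gcongr
    _ = (2 ^ r * M * ρ) * S + ε / 2 * S := by ring
    _ ≤ ε / 2 * S + ε / 2 * S := by gcongr
    _ = ε * S := by ring

end Composition

end DifferenceEquation

/-! ### The fixed point operator and its derivatives -/

namespace DifferenceEquation

section Orbit

variable {E F : Type} [NormedAddCommGroup E] [NormedSpace ℝ E] [NormedAddCommGroup F]
  [NormedSpace ℝ F]

/-- The map `z ↦ (P z, P (Λ z), …, P (Λ^N z))`. -/
def orbit (N : ℕ) (Λ : E →L[ℝ] E) (P : E → F) (z : E) : Fin (N + 1) → F :=
  fun j => P ((Λ ^ (j : ℕ)) z)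

/-- The map `z ↦ ∑ i, L i (P (Λ^{i+1} z))`. -/
def linearStep {N : ℕ} (Λ : E →L[ℝ] E) (L : Fin N → F →L[ℝ] F) (P : E → F) (z : E) : F :=
  ∑ i, L i (P ((Λ ^ ((i : ℕ) + 1)) z))

/-- The operator whose fixed points are the parameterizations. -/
def step {N : ℕ} (Λ : E →L[ℝ] E) (L : Fin N → F →L[ℝ] F) (g : (Fin (N + 1) → F) → F) (P : E → F)
    (z : E) : F :=
  linearStep Λ L P z + g (orbit N Λ P z)

variable {N r : ℕ} {Λ : E →L[ℝ] E} {L : Fin N → F →L[ℝ] F} {g : (Fin (N + 1) → F) → F} {P Q : E → F}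

theorem contDiff_orbit {n : WithTop ℕ∞} (hP : ContDiff ℝ n P) : ContDiff ℝ n (orbit N Λ P) :=
  contDiff_pi.2 fun j => hP.comp (Λ ^ (j : ℕ)).contDiff

theorem contDiff_linearStep {n : WithTop ℕ∞} (hP : ContDiff ℝ n P) :
    ContDiff ℝ n (linearStep Λ L P) :=
  ContDiff.sum fun i _ => (L i).contDiff.comp (hP.comp (Λ ^ ((i : ℕ) + 1)).contDiff)

theorem contDiff_step {n : WithTop ℕ∞} (hg : ContDiff ℝ n g) (hP : ContDiff ℝ n P) :
    ContDiff ℝ n (step Λ L g P) :=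
  (contDiff_linearStep hP).add (hg.comp (contDiff_orbit hP))

theorem step_zero (hg0 : g 0 = 0) (hP0 : P 0 = 0) : step Λ L g P 0 = 0 := by
  have : orbit N Λ P 0 = 0 := by
    funext j
    simp [orbit, hP0]
  simp [step, linearStep, this, hP0, hg0]

theorem step_sub_step (z : E) :
    step Λ L g Q z - step Λ L g P z =
      linearStep Λ L (fun z => Q z - P z) z + (g (orbit N Λ Q z) - g (orbit N Λ P z)) := by
  simp only [step, linearStep, map_sub, Finset.sum_sub_distrib]
  abel

theorem iteratedFDeriv_linearStep {k : ℕ} (hP : ContDiff ℝ k P) (z : E) :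
    iteratedFDeriv ℝ k (linearStep Λ L P) z = ∑ i, (L i).compContinuousMultilinearMap
      ((iteratedFDeriv ℝ k P ((Λ ^ ((i : ℕ) + 1)) z)).compContinuousLinearMap
        fun _ => Λ ^ ((i : ℕ) + 1)) := by
  have h : linearStep Λ L P = ∑ i, (L i) ∘ (P ∘ (Λ ^ ((i : ℕ) + 1))) := by
    funext z
    simp [linearStep]
  have hc : ∀ i : Fin N, ContDiff ℝ k (P ∘ (Λ ^ ((i : ℕ) + 1))) := fun i =>
    hP.comp (Λ ^ ((i : ℕ) + 1)).contDiff
  rw [h, iteratedFDeriv_sum_apply fun i _ => ((L i).contDiff.comp (hc i)).contDiffAt]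
  refine Finset.sum_congr rfl fun i _ => ?_
  rw [(L i).iteratedFDeriv_comp_left (hc i).contDiffAt le_rfl,
    (Λ ^ ((i : ℕ) + 1)).iteratedFDeriv_comp_right hP z le_rfl]

theorem iteratedFDeriv_orbit_apply {k : ℕ} (hP : ContDiff ℝ k P) (z : E) (w : Fin k → E)
    (j : Fin (N + 1)) :
    iteratedFDeriv ℝ k (orbit N Λ P) z w j =
      iteratedFDeriv ℝ k P ((Λ ^ (j : ℕ)) z) (fun i => (Λ ^ (j : ℕ)) (w i)) := by
  have h1 := (ContinuousLinearMap.proj (R := ℝ) (φ := fun _ : Fin (N + 1) => F)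
    j).iteratedFDeriv_comp_left (contDiff_orbit (N := N) (Λ := Λ) hP).contDiffAt (x := z) le_rfl
  have h2 := (Λ ^ (j : ℕ)).iteratedFDeriv_comp_right hP z le_rfl
  have h3 : (ContinuousLinearMap.proj (R := ℝ) (φ := fun _ : Fin (N + 1) => F) j) ∘
      orbit N Λ P = P ∘ (Λ ^ (j : ℕ)) := rfl
  rw [h3, h2] at h1
  exact (DFunLike.congr_fun h1 w).symm

theorem iteratedFDeriv_step_sub_step {k : ℕ} (hg : ContDiff ℝ k g) (hP : ContDiff ℝ k P)
    (hQ : ContDiff ℝ k Q) (z : E) :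
    iteratedFDeriv ℝ k (fun z => step Λ L g Q z - step Λ L g P z) z =
      iteratedFDeriv ℝ k (linearStep Λ L fun z => Q z - P z) z +
        iteratedFDeriv ℝ k (fun z => g (orbit N Λ Q z) - g (orbit N Λ P z)) z := by
  simp only [step_sub_step]
  exact fun_iteratedFDeriv_add_apply (contDiff_linearStep (hQ.sub hP)).contDiffAt
    ((hg.comp (contDiff_orbit hQ)).sub (hg.comp (contDiff_orbit hP))).contDiffAt

theorem norm_pow_le_one (hΛ : ‖Λ‖ ≤ 1) (j : ℕ) : ‖Λ ^ j‖ ≤ 1 := by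
  induction j with
  | zero => exact ContinuousLinearMap.norm_id_le
  | succ j ih =>
    rw [pow_succ]
    exact (norm_mul_le _ _).trans (mul_le_one₀ ih (norm_nonneg _) hΛ)

theorem pow_mem_ball (hΛ : ‖Λ‖ ≤ 1) (j : ℕ) {ρ : ℝ} {z : E} (hz : z ∈ Metric.ball (0 : E) ρ) :
    (Λ ^ j) z ∈ Metric.ball (0 : E) ρ := by
  rw [mem_ball_zero_iff] at hz ⊢
  refine ((Λ ^ j).le_opNorm z).trans_lt (lt_of_le_of_lt ?_ hz)
  exact mul_le_of_le_one_left (norm_nonneg _) (norm_pow_le_one hΛ j)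

theorem norm_iteratedFDeriv_orbit_le (hΛ : ‖Λ‖ ≤ 1) {k : ℕ} (hP : ContDiff ℝ k P) {ρ K : ℝ}
    (hK : ∀ z ∈ Metric.ball (0 : E) ρ, ‖iteratedFDeriv ℝ k P z‖ ≤ K) :
    ∀ z ∈ Metric.ball (0 : E) ρ, ‖iteratedFDeriv ℝ k (orbit N Λ P) z‖ ≤ K := by
  intro z hz
  have hK0 : 0 ≤ K := (norm_nonneg _).trans (hK z hz)
  refine ContinuousMultilinearMap.opNorm_le_bound hK0 fun w => ?_
  refine (pi_norm_le_iff_of_nonneg (by positivity)).2 fun j => ?_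
  rw [iteratedFDeriv_orbit_apply hP]
  refine (ContinuousMultilinearMap.le_opNorm _ _).trans ?_
  gcongr with i
  · exact hK _ (pow_mem_ball hΛ _ hz)
  · exact ((Λ ^ (j : ℕ)).le_opNorm _).trans
      (mul_le_of_le_one_left (norm_nonneg _) (norm_pow_le_one hΛ _))

theorem iteratedFDeriv_orbit_eq_zero {k : ℕ} (hP : ContDiff ℝ k P)
    (h0 : iteratedFDeriv ℝ k P 0 = 0) : iteratedFDeriv ℝ k (orbit N Λ P) 0 = 0 := by
  ext w j
  simp [iteratedFDeriv_orbit_apply hP, h0]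

theorem iteratedFDeriv_linearStep_eq_zero {k : ℕ} (hP : ContDiff ℝ k P)
    (h0 : iteratedFDeriv ℝ k P 0 = 0) : iteratedFDeriv ℝ k (linearStep Λ L P) 0 = 0 := by
  ext w
  simp [iteratedFDeriv_linearStep hP, h0]

/-- The chain rule inserts `Λ^{i+1}` into each of the `k` arguments, so higher order means stronger
contraction. For `k = r` the factor is the sum in `IsLargeOrder` at `μ = ‖Λ‖ ^ r`. -/
theorem norm_iteratedFDeriv_linearStep_le (hΛ : ‖Λ‖ ≤ 1) {k : ℕ} (hP : ContDiff ℝ k P) {ρ S : ℝ}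
    (hS : ∀ z ∈ Metric.ball (0 : E) ρ, ‖iteratedFDeriv ℝ k P z‖ ≤ S) :
    ∀ z ∈ Metric.ball (0 : E) ρ, ‖iteratedFDeriv ℝ k (linearStep Λ L P) z‖ ≤
      (∑ i : Fin N, (‖Λ‖ ^ k) ^ ((i : ℕ) + 1) * ‖L i‖) * S := by
  intro z hz
  rw [iteratedFDeriv_linearStep hP, Finset.sum_mul]
  refine norm_sum_le_of_le _ fun i _ => ?_
  have h1 := ContinuousMultilinearMap.norm_compContinuousLinearMap_le
    (iteratedFDeriv ℝ k P ((Λ ^ ((i : ℕ) + 1)) z)) (fun _ => Λ ^ ((i : ℕ) + 1))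
  have h2 : ‖Λ ^ ((i : ℕ) + 1)‖ ≤ ‖Λ‖ ^ ((i : ℕ) + 1) := norm_pow_le' _ (by omega)
  have h3 := hS _ (pow_mem_ball hΛ ((i : ℕ) + 1) hz)
  have hS0 : 0 ≤ S := (norm_nonneg _).trans h3
  calc _ ≤ ‖L i‖ * _ := ContinuousLinearMap.norm_compContinuousMultilinearMap_le _ _
    _ ≤ ‖L i‖ * (S * (‖Λ‖ ^ ((i : ℕ) + 1)) ^ k) := by
        gcongr
        refine h1.trans ?_
        simp only [Finset.prod_const, Finset.card_univ, Fintype.card_fin]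
        gcongr
    _ = _ := by
        rw [← pow_mul, ← pow_mul, mul_comm k]
        ring

end Orbit

/-! ### Contraction in the derivative of order `r` -/

section Contraction

variable {E F : Type} [NormedAddCommGroup E] [NormedSpace ℝ E] [NormedAddCommGroup F]
  [NormedSpace ℝ F] [FiniteDimensional ℝ F]
  {N r : ℕ} {Λ : E →L[ℝ] E} {L : Fin N → F →L[ℝ] F} {g : (Fin (N + 1) → F) → F}

/-- The linear part involves only derivatives of the same order, and `g`, having no linear part,
only lower ones. Hence all iterates share one jet. -/
theorem iteratedFDeriv_step_sub_step_eq_zero {P Q : E → F} {n : ℕ} (hn : n ≤ r)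
    (hg : ContDiff ℝ (r + 1 : ℕ) g) (hg' : fderiv ℝ g 0 = 0) (hP : ContDiff ℝ r P)
    (hQ : ContDiff ℝ r Q) (hP0 : P 0 = 0) (hQ0 : Q 0 = 0)
    (hPQ : ∀ k ≤ n, iteratedFDeriv ℝ k (fun z => Q z - P z) 0 = 0) {k : ℕ} (hk : k ≤ n) :
    iteratedFDeriv ℝ k (fun z => step Λ L g Q z - step Λ L g P z) 0 = 0 := by
  have hkr : (k : WithTop ℕ∞) ≤ r := by exact_mod_cast hk.trans hn
  have hgr : ContDiff ℝ k g := hg.of_le (by norm_cast; omega)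
  have hδ : ContDiff ℝ k (fun z => Q z - P z) := (hQ.sub hP).of_le hkr
  rw [iteratedFDeriv_step_sub_step hgr (hP.of_le hkr) (hQ.of_le hkr),
    iteratedFDeriv_linearStep_eq_zero hδ (hPQ k hk), zero_add]
  refine iteratedFDeriv_comp_sub_comp_eq_zero hn hg hg' (contDiff_orbit hP) (contDiff_orbit hQ)
    (funext fun j => by simp [orbit, hP0]) (funext fun j => by simp [orbit, hQ0]) ?_ hk
  intro l hl
  exact iteratedFDeriv_orbit_eq_zero (P := fun z => Q z - P z)
    ((hQ.sub hP).of_le (by norm_cast; omega)) (hPQ l hl.le)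

/-- The radius depends on `P` and `Q` only through `K`, so one ball serves every iterate. -/
theorem exists_norm_iteratedFDeriv_step_sub_step_le (hr : 1 ≤ r) (hΛ : ‖Λ‖ ≤ 1)
    (hg : ContDiff ℝ (r + 1 : ℕ) g) (hg' : fderiv ℝ g 0 = 0) {K ε : ℝ} (hK : 1 ≤ K) (hε : 0 < ε) :
    ∃ ρ₀ : ℝ, 0 < ρ₀ ∧ ρ₀ ≤ 1 ∧ ∀ ρ ≤ ρ₀, ∀ P Q : E → F, ContDiff ℝ r P → ContDiff ℝ r Q →
      P 0 = 0 → Q 0 = 0 →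
      (∀ k ≤ r, ∀ z ∈ Metric.ball (0 : E) ρ, ‖iteratedFDeriv ℝ k P z‖ ≤ K) →
      (∀ k ≤ r, ∀ z ∈ Metric.ball (0 : E) ρ, ‖iteratedFDeriv ℝ k Q z‖ ≤ K) →
      (∀ k < r, iteratedFDeriv ℝ k (fun z => Q z - P z) 0 = 0) → ∀ S : ℝ,
      (∀ z ∈ Metric.ball (0 : E) ρ, ‖iteratedFDeriv ℝ r (fun z => Q z - P z) z‖ ≤ S) →
      ∀ z ∈ Metric.ball (0 : E) ρ,
        ‖iteratedFDeriv ℝ r (fun z => step Λ L g Q z - step Λ L g P z) z‖ ≤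
          (∑ i : Fin N, (‖Λ‖ ^ r) ^ ((i : ℕ) + 1) * ‖L i‖ + ε) * S := by
  obtain ⟨ρ₀, hρ₀, hρ₁, H⟩ :=
    exists_norm_iteratedFDeriv_comp_sub_comp_le (E := E) hr hg hg' hK hε
  refine ⟨ρ₀, hρ₀, hρ₁, ?_⟩
  intro ρ hρ P Q hP hQ hP0 hQ0 hKP hKQ hPQ S hS z hz
  have hgr : ContDiff ℝ r g := hg.of_le (by norm_cast; omega)
  rw [iteratedFDeriv_step_sub_step hgr hP hQ, add_mul]
  refine norm_add_le_of_le (norm_iteratedFDeriv_linearStep_le hΛ (hQ.sub hP) hS z hz) ?_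
  refine H ρ hρ (orbit N Λ P) (orbit N Λ Q) (contDiff_orbit hP) (contDiff_orbit hQ)
    (funext fun j => by simp [orbit, hP0]) (funext fun j => by simp [orbit, hQ0]) ?_ ?_ ?_ S ?_ z hz
  · exact fun k hk => norm_iteratedFDeriv_orbit_le hΛ (hP.of_le (by exact_mod_cast hk)) (hKP k hk)
  · exact fun k hk => norm_iteratedFDeriv_orbit_le hΛ (hQ.of_le (by exact_mod_cast hk)) (hKQ k hk)
  · exact fun k hk => iteratedFDeriv_orbit_eq_zero (P := fun z => Q z - P z)
      ((hQ.sub hP).of_le (by exact_mod_cast hk.le)) (hPQ k hk)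
  · exact norm_iteratedFDeriv_orbit_le (P := fun z => Q z - P z) hΛ (hQ.sub hP) hS

end Contraction

end DifferenceEquation

/-! ### Convergence of the iteration -/

namespace DifferenceEquation

section FixedPoint

variable {E F : Type} [NormedAddCommGroup E] [NormedSpace ℝ E] [FiniteDimensional ℝ E]
  [NormedAddCommGroup F] [NormedSpace ℝ F] [FiniteDimensional ℝ F]
  {N r : ℕ} {Λ : E →L[ℝ] E} {L : Fin N → F →L[ℝ] F} {g : (Fin (N + 1) → F) → F}

/-- A map that satisfies the fixed point equation to order `r` at `0` is the beginning of a `C^r`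
solution of the equation near `0`. -/
theorem exists_contDiffOn_eq_step (hr : 1 ≤ r) (hΛ : ‖Λ‖ ≤ 1)
    (hL : ∑ i : Fin N, (‖Λ‖ ^ r) ^ ((i : ℕ) + 1) * ‖L i‖ < 1)
    (hg : ContDiff ℝ (r + 1 : ℕ) g) (hg0 : g 0 = 0) (hg' : fderiv ℝ g 0 = 0) {P₀ : E → F}
    (hP₀ : ContDiff ℝ r P₀) (hP₀0 : P₀ 0 = 0)
    (hjet : ∀ k ≤ r, iteratedFDeriv ℝ k (fun z => step Λ L g P₀ z - P₀ z) 0 = 0)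
    {η : ℝ} (hη : 0 < η) :
    ∃ ρ : ℝ, 0 < ρ ∧ ∃ P : E → F, ContDiffOn ℝ r P (Metric.ball 0 ρ) ∧ P 0 = 0 ∧
      (∀ z ∈ Metric.ball (0 : E) ρ, P z = step Λ L g P z) ∧
      (∀ z ∈ Metric.ball (0 : E) ρ, ‖P z‖ < η) ∧ fderiv ℝ P 0 = fderiv ℝ P₀ 0 := by
  have : ProperSpace E := FiniteDimensional.proper ℝ E
  have hgr : ContDiff ℝ r g := hg.of_le (by norm_cast; omega)
  set q : ℝ := ∑ i : Fin N, (‖Λ‖ ^ r) ^ ((i : ℕ) + 1) * ‖L i‖ with hq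
  have hq0 : 0 ≤ q := Finset.sum_nonneg fun i _ => by positivity
  -- The midpoint of `q` and `1`: the contraction rate when the nonlinear part is allowed `ε = (1 -
  -- q) / 2`.
  set κ : ℝ := q + (1 - q) / 2 with hκ
  have hκ0 : 0 ≤ κ := by rw [hκ]; linarith
  have hκ1 : κ < 1 := by rw [hκ]; linarith
  obtain ⟨K₀, hK₀0, hK₀⟩ := exists_norm_iteratedFDeriv_le_of_isCompact hP₀
    (isCompact_closedBall (0 : E) 1)
  -- The bound `K₀ + 1` leaves room for a total drift of `∑ (1 - κ) κ ^ n = 1` away from `P₀`.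
  obtain ⟨ρ₀, hρ₀, hρ₀1, hcontr⟩ := exists_norm_iteratedFDeriv_step_sub_step_le (E := E) (L := L)
    hr hΛ hg hg' (K := K₀ + 1) (ε := (1 - q) / 2) (by linarith) (by linarith)
  have hstart : ∀ᶠ z in 𝓝 (0 : E),
      ‖iteratedFDeriv ℝ r (fun z => step Λ L g P₀ z - P₀ z) z‖ < 1 - κ := by
    have hc := (((contDiff_step (Λ := Λ) (L := L) hgr hP₀).sub hP₀).continuous_iteratedFDeriv
      (m := r) le_rfl).norm.tendsto 0
    rw [hjet r le_rfl, norm_zero] at hc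
    exact hc.eventually_lt_const (by linarith)
  obtain ⟨ρ₁, hρ₁, hstart⟩ := Metric.eventually_nhds_iff_ball.1 hstart
  -- The iterates will be `(K₀ + 1)`-Lipschitz on the ball, so the last condition keeps their values
  -- below `η`.
  obtain ⟨ρ, hρ, hρρ₀, hρρ₁, hρη⟩ : ∃ ρ : ℝ, 0 < ρ ∧ ρ ≤ ρ₀ ∧ ρ ≤ ρ₁ ∧ (K₀ + 1) * ρ < η := by
    refine ⟨min ρ₀ (min ρ₁ (η / (2 * (K₀ + 1)))), by positivity, min_le_left _ _,
      (min_le_right _ _).trans (min_le_left _ _), ?_⟩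
    have h := (min_le_right ρ₀ _).trans (min_le_right ρ₁ (η / (2 * (K₀ + 1))))
    rw [le_div_iff₀ (by positivity)] at h
    linarith
  have hρ1 : ρ ≤ 1 := hρρ₀.trans hρ₀1
  set p : ℕ → E → F := fun n => (step Λ L g)^[n] P₀ with hp
  have hpsucc : ∀ n, p (n + 1) = step Λ L g (p n) := fun n =>
    Function.iterate_succ_apply' _ _ _
  have hpc : ∀ n, ContDiff ℝ r (p n) := by
    intro n
    induction n with
    | zero => exact hP₀
    | succ n ih =>
      rw [hpsucc]
      exact contDiff_step hgr ih
  have hp0 : ∀ n, p n 0 = 0 := by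
    intro n
    induction n with
    | zero => exact hP₀0
    | succ n ih =>
      rw [hpsucc]
      exact step_zero hg0 ih
  set δ : ℕ → E → F := fun n z => p (n + 1) z - p n z with hδ
  have hδc : ∀ n, ContDiff ℝ r (δ n) := fun n => (hpc (n + 1)).sub (hpc n)
  have hδsucc : ∀ n, δ (n + 1) = fun z => step Λ L g (p (n + 1)) z - step Λ L g (p n) z := by
    intro n
    simp only [hδ, hpsucc]
  have hδjet : ∀ n, ∀ k ≤ r, iteratedFDeriv ℝ k (δ n) 0 = 0 := by
    intro n
    induction n with
    | zero => exact hjet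
    | succ n ih =>
      intro k hk
      rw [hδsucc]
      exact iteratedFDeriv_step_sub_step_eq_zero le_rfl hg hg' (hpc n) (hpc (n + 1)) (hp0 n)
        (hp0 (n + 1)) ih hk
  have hlower : ∀ n, ∀ S : ℝ, (∀ z ∈ Metric.ball (0 : E) ρ, ‖iteratedFDeriv ℝ r (δ n) z‖ ≤ S) →
      ∀ k ≤ r, ∀ z ∈ Metric.ball (0 : E) ρ, ‖iteratedFDeriv ℝ k (δ n) z‖ ≤ S := by
    intro n S hS k hk z hz
    have h := norm_iteratedFDeriv_le_of_vanish (hδc n) (fun k hk => hδjet n k hk.le) hS (r - k)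
      (by omega) z hz
    rw [Nat.sub_sub_self hk] at h
    exact h.trans (mul_le_of_le_one_right ((norm_nonneg _).trans (hS z hz))
      (pow_le_one₀ hρ.le hρ1))
  have hgeom : ∀ n : ℕ, (1 - κ) * ∑ j ∈ Finset.range n, κ ^ j ≤ 1 := by
    intro n
    rw [mul_neg_geom_sum]
    have := pow_nonneg hκ0 n
    linarith
  -- The two bounds need a joint induction: the contraction estimate requires `p n` and `p (n + 1)`
  -- to stay within `K₀ + 1`.
  have hbounds : ∀ n : ℕ,
      (∀ k ≤ r, ∀ z ∈ Metric.ball (0 : E) ρ, ‖iteratedFDeriv ℝ k (p n) z‖ ≤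
        K₀ + (1 - κ) * ∑ j ∈ Finset.range n, κ ^ j) ∧
      (∀ z ∈ Metric.ball (0 : E) ρ, ‖iteratedFDeriv ℝ r (δ n) z‖ ≤ (1 - κ) * κ ^ n) := by
    intro n
    induction n with
    | zero =>
      refine ⟨fun k hk z hz => ?_, fun z hz => ?_⟩
      · exact (hK₀ k hk z
          (Metric.ball_subset_closedBall (Metric.ball_subset_ball hρ1 hz))).trans (by simp)
      · exact (hstart z (Metric.ball_subset_ball hρρ₁ hz)).le.trans (by simp)
    | succ n ih =>
      have hnext : ∀ k ≤ r, ∀ z ∈ Metric.ball (0 : E) ρ, ‖iteratedFDeriv ℝ k (p (n + 1)) z‖ ≤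
          K₀ + (1 - κ) * ∑ j ∈ Finset.range (n + 1), κ ^ j := by
        intro k hk z hz
        have hk' : (k : WithTop ℕ∞) ≤ r := by exact_mod_cast hk
        have h1 : p (n + 1) = p n + δ n := by
          funext y
          simp [hδ]
        rw [h1, iteratedFDeriv_add_apply ((hpc n).of_le hk').contDiffAt
          ((hδc n).of_le hk').contDiffAt, Finset.sum_range_succ, mul_add, ← add_assoc]
        exact norm_add_le_of_le (ih.1 k hk z hz) (hlower n _ ih.2 k hk z hz)
      refine ⟨hnext, fun z hz => ?_⟩
      have h := hcontr ρ hρρ₀ (p n) (p (n + 1)) (hpc n) (hpc (n + 1)) (hp0 n) (hp0 (n + 1))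
        (fun k hk z hz => (ih.1 k hk z hz).trans (by linarith [hgeom n]))
        (fun k hk z hz => (hnext k hk z hz).trans (by linarith [hgeom (n + 1)]))
        (fun k hk => hδjet n k hk.le) _ ih.2 z hz
      rw [hδsucc]
      refine h.trans (le_of_eq ?_)
      rw [← hκ]
      ring
  have hu : Summable fun n : ℕ => (1 - κ) * κ ^ n :=
    (summable_geometric_of_lt_one hκ0 hκ1).mul_left _
  have hδbound : ∀ k ≤ r, ∀ n, ∀ z ∈ Metric.ball (0 : E) ρ,
      ‖iteratedFDeriv ℝ k (δ n) z‖ ≤ (1 - κ) * κ ^ n :=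
    fun k hk n => hlower n _ (hbounds n).2 k hk
  have hball : (0 : E) ∈ Metric.ball (0 : E) ρ := Metric.mem_ball_self hρ
  have hsum : ∀ z ∈ Metric.ball (0 : E) ρ, Summable fun n => δ n z := fun z hz =>
    .of_norm_bounded hu fun n => by
      simpa [norm_iteratedFDeriv_zero] using hδbound 0 (by omega) n z hz
  set P : E → F := fun z => P₀ z + ∑' n, δ n z with hP
  have hlim : ∀ z ∈ Metric.ball (0 : E) ρ, Tendsto (fun n => p n z) atTop (𝓝 (P z)) := by
    intro z hz
    have h1 : ∀ n, p n z = P₀ z + ∑ j ∈ Finset.range n, δ j z := by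
      intro n
      simp only [hδ]
      rw [Finset.sum_range_sub (fun j => p j z)]
      simp [hp]
    simp only [h1]
    exact (hsum z hz).hasSum.tendsto_sum_nat.const_add _
  refine ⟨ρ, hρ, P, ?_, ?_, ?_, ?_, ?_⟩
  · exact hP₀.contDiffOn.add (contDiffOn_tsum_of_isPreconnected Metric.isOpen_ball
      (convex_ball (0 : E) ρ).isPreconnected hδc hu hδbound)
  · have h : ∀ n, δ n 0 = 0 := fun n => by simp [hδ, hp0]
    simp [hP, h, hP₀0]
  · intro z hz
    have h1 : Tendsto (fun n => p (n + 1) z) atTop (𝓝 (P z)) :=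
      (hlim z hz).comp (tendsto_add_atTop_nat 1)
    -- Pointwise convergence is enough, because `Λ` maps the ball into itself.
    have h2 : Tendsto (fun n => step Λ L g (p n) z) atTop (𝓝 (step Λ L g P z)) := by
      refine Tendsto.add (tendsto_finsetSum _ fun i _ => ?_) ?_
      · exact ((L i).continuous.tendsto _).comp (hlim _ (pow_mem_ball hΛ _ hz))
      · exact (hgr.continuous.tendsto _).comp
          (tendsto_pi_nhds.2 fun j => hlim _ (pow_mem_ball hΛ _ hz))
    simp only [hpsucc] at h1
    exact tendsto_nhds_unique h1 h2
  · intro z hz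
    refine lt_of_le_of_lt (le_of_tendsto (hlim z hz).norm (.of_forall fun n => ?_)) hρη
    have h := (convex_ball (0 : E) ρ).norm_image_sub_le_of_norm_fderiv_le (𝕜 := ℝ) (f := p n)
      (C := K₀ + 1) (fun y _ => (hpc n).differentiable (by norm_cast; omega) y)
      (fun y hy => by
        rw [← norm_iteratedFDeriv_one]
        exact ((hbounds n).1 1 hr y hy).trans (by linarith [hgeom n])) hball hz
    rw [hp0, sub_zero, sub_zero] at h
    have := (mem_ball_zero_iff.1 hz).le
    exact h.trans (by gcongr)
  · have hδd : ∀ n z, HasFDerivAt (δ n) (fderiv ℝ (δ n) z) z := fun n z =>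
      ((hδc n).differentiable (by norm_cast; omega) z).hasFDerivAt
    -- As `r ≥ 1`, the vanishing jets include the first derivative, so the series adds nothing to
    -- `P₀'(0)`.
    have hδ0 : ∀ n, fderiv ℝ (δ n) 0 = 0 := by
      intro n
      rw [← norm_eq_zero, ← norm_iteratedFDeriv_one, hδjet n 1 hr, norm_zero]
    have h := hasFDerivAt_tsum_of_isPreconnected hu Metric.isOpen_ball
      (convex_ball (0 : E) ρ).isPreconnected (fun n z _ => hδd n z)
      (fun n z hz => by
        rw [← norm_iteratedFDeriv_one]
        exact hδbound 1 hr n z hz) hball (hsum 0 hball) hball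
    simp only [hδ0, tsum_zero] at h
    have h0 := (hP₀.differentiable (by norm_cast; omega) 0).hasFDerivAt.add h
    rw [add_zero] at h0
    exact h0.fderiv

end FixedPoint

end DifferenceEquation

/-! ### Formal solution up to order `r` -/

namespace DifferenceEquation

section Jets

variable {F : Type} [NormedAddCommGroup F] [NormedSpace ℝ F] {m N : ℕ} {lam : Fin m → ℝ}
  {L : Fin N → F →L[ℝ] F} {g : (Fin (N + 1) → F) → F}

theorem diagMap_apply (z : Fin m → ℝ) (i : Fin m) : diagMap lam z i = lam i * z i := by
  simp [diagMap, Matrix.mulVec_diagonal]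

theorem diagMap_pow_apply (j : ℕ) (z : Fin m → ℝ) (i : Fin m) :
    (diagMap lam ^ j) z i = lam i ^ j * z i := by
  induction j with
  | zero => simp
  | succ j ih =>
    rw [pow_succ', mul_apply_eq_comp, diagMap_apply, ih]
    ring

/-- The homogeneous equation of degree `n` is solvable if the values of the characteristic
polynomial at the monomials of degree `n` are invertible. -/
theorem exists_multilinear_sub_eq {n : ℕ}
    (hsolve : ∀ f : Fin n → Fin m, ∀ y : F, ∃ c : F,
      c - ∑ i : Fin N, (∏ j, lam (f j)) ^ ((i : ℕ) + 1) • L i c = y)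
    (A : (Fin m → ℝ) [×n]→L[ℝ] F) :
    ∃ C : (Fin m → ℝ) [×n]→L[ℝ] F, ∀ w : Fin n → Fin m → ℝ,
      C w - ∑ i : Fin N, L i (C fun j => (diagMap lam ^ ((i : ℕ) + 1)) (w j)) = A w := by
  -- As `Λ` is diagonal, the equation decouples over tuples `f` of basis vectors, where `Λ^{i+1}`
  -- acts as a scalar.
  choose c hc using fun f : Fin n → Fin m => hsolve f (A fun j => Pi.single (f j) 1)
  let C : (Fin m → ℝ) [×n]→L[ℝ] F := ∑ f : Fin n → Fin m,
    ((ContinuousMultilinearMap.mkPiAlgebra ℝ (Fin n) ℝ).compContinuousLinearMap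
      fun j => ContinuousLinearMap.proj (R := ℝ) (φ := fun _ : Fin m => ℝ) (f j)).smulRight (c f)
  have hC : ∀ w, C w = ∑ f : Fin n → Fin m, (∏ j, w j (f j)) • c f := by
    intro w
    simp [C]
  refine ⟨C, fun w => ?_⟩
  have hA : A w = ∑ f : Fin n → Fin m, (∏ j, w j (f j)) • A (fun j => Pi.single (f j) 1) := by
    have hw : w = fun j => ∑ i, w j i • (Pi.single i (1 : ℝ) : Fin m → ℝ) := by
      funext j
      exact pi_eq_sum_univ' (w j)
    conv_lhs => rw [hw]
    rw [A.map_sum]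
    exact Finset.sum_congr rfl fun f _ => A.map_smul_univ _ _
  simp only [hC, diagMap_pow_apply, Finset.prod_mul_distrib, map_sum, map_smul, hA, ← hc, smul_sub,
    Finset.sum_sub_distrib, Finset.smul_sum]
  congr 1
  rw [Finset.sum_comm]
  refine Finset.sum_congr rfl fun f _ => Finset.sum_congr rfl fun i _ => ?_
  rw [Finset.prod_pow, smul_smul, mul_comm]

theorem contDiff_diagonal {E : Type*} [NormedAddCommGroup E] [NormedSpace ℝ E] {n : ℕ}
    {k : WithTop ℕ∞} (C : E [×n]→L[ℝ] F) : ContDiff ℝ k fun z => C fun _ => z :=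
  C.contDiff.comp (contDiff_pi.2 fun _ => contDiff_id)

/-- The derivative of order `k` of an `n`-linear map at `z` is bounded by a multiple of `‖z‖ ^ (n -
k)`, and the diagonal embedding is linear. -/
theorem iteratedFDeriv_diagonal_eq_zero {E : Type*} [NormedAddCommGroup E] [NormedSpace ℝ E]
    {n k : ℕ} (hk : k < n) (C : E [×n]→L[ℝ] F) :
    iteratedFDeriv ℝ k (fun z => C fun _ => z) 0 = 0 := by
  have h := (ContinuousLinearMap.pi fun _ : Fin n =>
    ContinuousLinearMap.id ℝ E).iteratedFDeriv_comp_right C.contDiff 0 (i := k) (n := k) le_rfl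
  have h0 : iteratedFDeriv ℝ k C 0 = 0 := by
    have h1 := C.norm_iteratedFDeriv_le k 0
    rw [norm_zero, Fintype.card_fin, zero_pow (by omega), mul_zero] at h1
    exact norm_le_zero_iff.1 h1
  change iteratedFDeriv ℝ k (C ∘ ContinuousLinearMap.pi fun _ : Fin n =>
    ContinuousLinearMap.id ℝ E) 0 = 0
  rw [h, map_zero, h0]
  ext w
  simp

/-- In the absence of resonances the linear part of a parameterization can be extended to a
solution of the equation to any order. -/
theorem exists_contDiff_jet [FiniteDimensional ℝ F] {r : ℕ}
    (hsolve : ∀ n, 2 ≤ n → ∀ f : Fin n → Fin m, ∀ y : F, ∃ c : F,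
      c - ∑ i : Fin N, (∏ j, lam (f j)) ^ ((i : ℕ) + 1) • L i c = y)
    (hg : ContDiff ℝ (r + 1 : ℕ) g) (hg0 : g 0 = 0) (hg' : fderiv ℝ g 0 = 0)
    (A : (Fin m → ℝ) →L[ℝ] F) (hA : ∀ z, linearStep (diagMap lam) L A z = A z) {k : ℕ}
    (hk : 1 ≤ k) (hkr : k ≤ r) :
    ∃ P : (Fin m → ℝ) → F, ContDiff ℝ r P ∧ P 0 = 0 ∧ fderiv ℝ P 0 = A ∧
      ∀ j ≤ k, iteratedFDeriv ℝ j (fun z => step (diagMap lam) L g P z - P z) 0 = 0 := by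
  have hgr : ContDiff ℝ r g := hg.of_le (by norm_cast; omega)
  induction k, hk using Nat.le_induction with
  | base =>
    refine ⟨A, A.contDiff, map_zero A, A.fderiv, fun j hj => ?_⟩
    -- Since `A` solves the linear equation, the residual is `g` along the orbit of `A`, compared
    -- here with `g` at `0`.
    have h := iteratedFDeriv_comp_sub_comp_eq_zero hkr hg hg' (a := fun _ => 0)
      (b := orbit N (diagMap lam) A) contDiff_const (contDiff_orbit A.contDiff) rfl
      (funext fun i => by simp [orbit]) (fun i hi => ?_) hj
    · simpa [step, hA, hg0] using h
    · obtain rfl : i = 0 := by omega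
      ext w
      simp [orbit]
  | succ k hk ih =>
    obtain ⟨P, hP, hP0, hP', hjet⟩ := ih (by omega)
    set R : (Fin m → ℝ) → F := fun z => step (diagMap lam) L g P z - P z with hR
    have hRc : ContDiff ℝ r R := (contDiff_step hgr hP).sub hP
    -- The correction `C (z, …, z)` must cancel the residual in degree `k + 1`; its derivative of
    -- that order sums `C` over permutations, hence the factorial.
    obtain ⟨C, hC⟩ := exists_multilinear_sub_eq (hsolve (k + 1) (by omega))
      (((k + 1).factorial : ℝ)⁻¹ • iteratedFDeriv ℝ (k + 1) R 0)
    set Q : (Fin m → ℝ) → F := fun z => C fun _ => z with hQ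
    have hQc : ContDiff ℝ r Q := contDiff_diagonal C
    have hQjet : ∀ j < k + 1, iteratedFDeriv ℝ j Q 0 = 0 := fun j hj =>
      iteratedFDeriv_diagonal_eq_zero hj C
    have hQ0 : Q 0 = 0 := by
      rw [← norm_eq_zero, ← norm_iteratedFDeriv_zero (𝕜 := ℝ), hQjet 0 (by omega), norm_zero]
    have hQ' : fderiv ℝ Q 0 = 0 := by
      rw [← norm_eq_zero, ← norm_iteratedFDeriv_one, hQjet 1 (by omega), norm_zero]
    have hPQ : ContDiff ℝ r (fun z => P z + Q z) := hP.add hQc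
    refine ⟨fun z => P z + Q z, hPQ, by simp [hP0, hQ0], ?_, fun j hj => ?_⟩
    · rw [fderiv_fun_add (hP.differentiable (by norm_cast; omega) 0)
        (hQc.differentiable (by norm_cast; omega) 0), hP', hQ', add_zero]
    · have hjr : (j : WithTop ℕ∞) ≤ r := by norm_cast; omega
      have hgj := hgr.of_le hjr
      have hPj := hP.of_le hjr
      have hQj := hQc.of_le hjr
      have hsplit : (fun z => step (diagMap lam) L g (fun z => P z + Q z) z - (P z + Q z)) =
          fun z => (step (diagMap lam) L g (fun z => P z + Q z) z - step (diagMap lam) L g P z) +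
            (R z - Q z) := by
        funext z
        simp only [hR]
        abel
      -- Adding `Q`, of degree `k + 1`, leaves the nonlinear part unchanged through order `k + 1`.
      have hnl : iteratedFDeriv ℝ j (fun z => g (orbit N (diagMap lam) (fun z => P z + Q z) z) -
          g (orbit N (diagMap lam) P z)) 0 = 0 := by
        refine iteratedFDeriv_comp_sub_comp_eq_zero hkr hg hg' (contDiff_orbit hP)
          (contDiff_orbit hPQ) (funext fun i => by simp [orbit, hP0])
          (funext fun i => by simp [orbit, hP0, hQ0]) (fun l hl => ?_) hj
        have : (fun z => orbit N (diagMap lam) (fun z => P z + Q z) z - orbit N (diagMap lam) P z) =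
            orbit N (diagMap lam) Q := by
          funext z i
          simp [orbit]
        rw [this]
        exact iteratedFDeriv_orbit_eq_zero (hQc.of_le (by norm_cast; omega)) (hQjet l hl)
      rw [hsplit, fun_iteratedFDeriv_add_apply
        ((contDiff_step hgj (hPj.add hQj)).sub (contDiff_step hgj hPj)).contDiffAt
        ((hRc.of_le hjr).sub hQj).contDiffAt,
        fun_iteratedFDeriv_sub_apply (hRc.of_le hjr).contDiffAt hQj.contDiffAt,
        iteratedFDeriv_step_sub_step hgj hPj (hPj.add hQj), hnl, add_zero]
      simp only [add_sub_cancel_left]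
      rcases hj.lt_or_eq with hj | rfl
      · rw [iteratedFDeriv_linearStep_eq_zero hQj (hQjet j hj), hjet j (by omega), hQjet j hj]
        simp
      · ext w
        -- `C` need not be symmetric; symmetry of the residual's derivative makes the `(k + 1)!`
        -- terms equal.
        have hsymm : ∀ σ : Equiv.Perm (Fin (k + 1)),
            iteratedFDeriv ℝ (k + 1) R 0 (fun i => w (σ i)) = iteratedFDeriv ℝ (k + 1) R 0 w :=
          fun σ => iteratedFDeriv_comp_perm_of_contDiff (hRc.of_le hjr) 0 w σ
        have hlin : iteratedFDeriv ℝ (k + 1) (linearStep (diagMap lam) L Q) 0 w =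
            ∑ σ : Equiv.Perm (Fin (k + 1)),
              ∑ i : Fin N, L i (C fun j => (diagMap lam ^ ((i : ℕ) + 1)) (w (σ j))) := by
          rw [iteratedFDeriv_linearStep hQj, Finset.sum_comm]
          simp [hQ, ContinuousMultilinearMap.iteratedFDeriv_comp_diagonal]
        have hfac : ((k + 1).factorial : ℝ) ≠ 0 := by positivity
        have hsum : iteratedFDeriv ℝ (k + 1) Q 0 w -
            iteratedFDeriv ℝ (k + 1) (linearStep (diagMap lam) L Q) 0 w =
              iteratedFDeriv ℝ (k + 1) R 0 w := by
          rw [hlin, hQ, ContinuousMultilinearMap.iteratedFDeriv_comp_diagonal,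
            ← Finset.sum_sub_distrib]
          simp only [hC, smul_apply, hsymm, Finset.sum_const,
            Finset.card_univ, Fintype.card_perm, Fintype.card_fin]
          rw [← Nat.cast_smul_eq_nsmul ℝ, smul_smul, mul_inv_cancel₀ hfac, one_smul]
        simp only [add_apply, sub_apply, ← hsum]
        simp

end Jets

end DifferenceEquation

/-! ### Localization and the linear algebra of `T` -/

namespace DifferenceEquation

section Main

/-- A map that is `C^n` near `0` agrees near `0` with a globally `C^n` map. -/
theorem exists_contDiff_eqOn_ball {X V : Type*} [NormedAddCommGroup X] [NormedSpace ℝ X]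
    [FiniteDimensional ℝ X] [NormedAddCommGroup V] [NormedSpace ℝ V] {n : ℕ} {f : X → V} {U : Set X}
    (hU : IsOpen U) (h0 : (0 : X) ∈ U) (hf : ContDiffOn ℝ n f U) :
    ∃ g : X → V, ∃ τ : ℝ, 0 < τ ∧ ContDiff ℝ n g ∧ Metric.ball 0 τ ⊆ U ∧
      ∀ x ∈ Metric.ball (0 : X) τ, g x = f x := by
  obtain ⟨s, hs, hsU⟩ := Metric.isOpen_iff.1 hU 0 h0
  let φ : ContDiffBump (0 : X) := ⟨s / 4, s / 2, by positivity, by linarith⟩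
  refine ⟨fun x => φ x • f x, s / 4, by positivity, ?_,
    (Metric.ball_subset_ball (by linarith)).trans hsU, fun x hx => ?_⟩
  · refine contDiff_iff_contDiffAt.2 fun x => ?_
    by_cases hx : x ∈ Metric.ball (0 : X) s
    · exact φ.contDiffAt.smul (hf.contDiffAt (hU.mem_nhds (hsU hx)))
    · have hx' : x ∈ (Metric.closedBall (0 : X) (s / 2))ᶜ := fun h =>
        hx (Metric.closedBall_subset_ball (by linarith) h)
      refine (contDiffAt_const (c := (0 : V))).congr_of_eventuallyEq ?_
      filter_upwards [Metric.isClosed_closedBall.isOpen_compl.mem_nhds hx'] with y hy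
      have hφ : φ y = 0 := φ.zero_of_le_dist (by
        rw [mem_compl_iff, Metric.mem_closedBall, not_le] at hy
        exact hy.le)
      simp [hφ]
  · have hφ : φ x = 1 := φ.one_of_mem_closedBall (Metric.ball_subset_closedBall hx)
    simp [hφ]

variable {d m N : ℕ} {Z : EqFun d N} {lam : Fin m → ℝ}

theorem norm_diagMap_le (lam : Fin m → ℝ) : ‖diagMap lam‖ ≤ ‖lam‖ := by
  refine ContinuousLinearMap.opNorm_le_bound _ (norm_nonneg _) fun z => ?_
  refine (pi_norm_le_iff_of_nonneg (by positivity)).2 fun i => ?_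
  rw [diagMap_apply, norm_mul]
  gcongr
  · exact norm_le_pi_norm lam i
  · exact norm_le_pi_norm z i

theorem IsStable.norm_diagMap_lt_one (h : IsStable lam) : ‖diagMap lam‖ < 1 :=
  (norm_diagMap_le lam).trans_lt ((pi_norm_lt_iff one_pos).2 h)

/-- The choice `μ = ‖Λ‖ ^ r` tends to `0`, and every exponent in the sum is at least `1`. -/
theorem IsStable.exists_isLargeOrder (h : IsStable lam) :
    ∃ r₀ : ℕ, ∀ r ≥ r₀, IsLargeOrder Z lam r := by
  have h1 := tendsto_pow_atTop_nhds_zero_of_lt_one (norm_nonneg _) h.norm_diagMap_lt_one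
  have h2 : Tendsto (fun r : ℕ => ∑ i : Fin N, (‖diagMap lam‖ ^ r) ^ ((i : ℕ) + 1) *
      ‖(B Z 0).inverse.comp (B Z i.succ)‖) atTop (𝓝 0) := by
    have := tendsto_finsetSum Finset.univ fun (i : Fin N) _ =>
      (h1.pow ((i : ℕ) + 1)).mul_const ‖(B Z 0).inverse.comp (B Z i.succ)‖
    simpa using this
  obtain ⟨r₀, hr₀⟩ := eventually_atTop.1
    ((h1.eventually_lt_const one_pos).and (h2.eventually_lt_const one_pos))
  exact ⟨r₀, fun r hr => ⟨_, le_rfl, hr₀ r hr⟩⟩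

theorem IsLargeOrder.one_le {r : ℕ} (h : IsLargeOrder Z lam r) : 1 ≤ r := by
  obtain ⟨μ, h1, h2, -⟩ := h
  by_contra hr
  obtain rfl : r = 0 := by omega
  rw [pow_zero] at h1
  linarith

theorem IsNonResonant.exists_isEigenvector (h : IsNonResonant Z lam) (i : Fin m) :
    ∃ v, IsEigenvector Z (lam i) v := by
  have h1 := (h (Pi.single i 1)).1 (by simp)
  have h2 : ∏ j, lam j ^ (Pi.single i 1 : Fin m → ℕ) j = lam i := by
    rw [Finset.prod_eq_single i (fun j _ hj => by simp [Pi.single_eq_of_ne hj]) (by simp)]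
    simp
  rw [h2] at h1
  obtain ⟨v, hv, hv0⟩ := (Submodule.ne_bot_iff _).1 (LinearMap.bot_lt_ker_of_det_eq_zero h1).ne'
  exact ⟨v, hv0, hv⟩

/-- Let `α i` count the occurrences of `i` in `f`: then `|α| = n` and `λ^α = ∏ lam (f j)`, so the
determinant is nonzero. -/
theorem IsNonResonant.surjective_T (h : IsNonResonant Z lam) {n : ℕ} (hn : 2 ≤ n)
    (f : Fin n → Fin m) : Function.Surjective (T Z (∏ j, lam (f j))) := by
  have h1 := (h fun i => (Finset.univ.filter fun j => f j = i).card).2 (by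
    rw [← Finset.card_eq_sum_card_fiberwise (fun _ _ => Finset.mem_univ _)]
    simp
    omega)
  have h2 : ∏ i, lam i ^ (Finset.univ.filter fun j => f j = i).card = ∏ j, lam (f j) := by
    rw [← Finset.prod_fiberwise' Finset.univ f lam]
    simp
  rw [h2] at h1
  exact (LinearMap.equivOfDetNeZero _ h1).surjective

theorem fderiv_apply_eq_sum (Z : EqFun d N) (θ : Fin (N + 1) → Fin d → ℝ) :
    fderiv ℝ Z 0 θ = ∑ j, B Z j (θ j) := by
  simp only [B, ContinuousLinearMap.comp_apply, ← map_sum]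
  congr 1
  exact (Finset.univ_sum_single θ).symm

theorem symm_fderiv_apply {e : (Fin d → ℝ) ≃L[ℝ] (Fin d → ℝ)} (he : B Z 0 = e)
    (θ : Fin (N + 1) → Fin d → ℝ) :
    e.symm (fderiv ℝ Z 0 θ) =
      θ 0 - ∑ i : Fin N, (-((e.symm : _ →L[ℝ] _).comp (B Z i.succ))) (θ i.succ) := by
  rw [fderiv_apply_eq_sum, Fin.sum_univ_succ, he]
  simp

theorem symm_T_apply {e : (Fin d → ℝ) ≃L[ℝ] (Fin d → ℝ)} (he : B Z 0 = e) (x : ℝ)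
    (c : Fin d → ℝ) :
    e.symm (T Z x c) =
      c - ∑ i : Fin N, x ^ ((i : ℕ) + 1) • (-((e.symm : _ →L[ℝ] _).comp (B Z i.succ))) c := by
  simp [T, Fin.sum_univ_succ, he]

end Main

end DifferenceEquation

/-! ### The parameterization theorem -/

theorem mainTheorem3 {d m N : ℕ}
    (U : Set (Fin (N + 1) → Fin d → ℝ)) (hU : IsOpen U) (h0U : 0 ∈ U)
    (Z : EqFun d N) (hZ0 : Z 0 = 0)
    (hB0 : (B Z 0).IsInvertible)
    (lam : Fin m → ℝ) (hstable : IsStable lam) (hnonres : IsNonResonant Z lam) :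
    -- every sufficiently large order of differentiability is admissible
    (∃ r₀ : ℕ, ∀ r ≥ r₀, IsLargeOrder Z lam r) ∧
    -- there are eigenvectors for the eigenvalues
    (∃ v : Fin m → Fin d → ℝ, ∀ i, IsEigenvector Z (lam i) (v i)) ∧
    -- the parameterization, for every admissible order and every choice of the eigenvectors
    ∀ r : ℕ, IsLargeOrder Z lam r → ContDiffOn ℝ ((r + 1 : ℕ) : WithTop ℕ∞) Z U →
      ∀ v : Fin m → Fin d → ℝ, (∀ i, IsEigenvector Z (lam i) (v i)) →
        ∃ ρ : ℝ, 0 < ρ ∧ ∃ P : (Fin m → ℝ) → (Fin d → ℝ),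
          ContDiffOn ℝ (r : WithTop ℕ∞) P (Metric.ball 0 ρ) ∧
          P 0 = 0 ∧
          (∀ z ∈ Metric.ball (0 : Fin m → ℝ) ρ,
            orbitTuple N lam P z ∈ U ∧ Z (orbitTuple N lam P z) = 0) ∧
          (∀ i, fderiv ℝ P 0 (Pi.single i 1) = v i) ∧
          LinearMap.range (fderiv ℝ P 0).toLinearMap = Submodule.span ℝ (Set.range v) := by
  refine ⟨hstable.exists_isLargeOrder,
    Classical.skolem.1 fun i => hnonres.exists_isEigenvector i, ?_⟩
  intro r hlarge hZ v hv
  have hr := hlarge.one_le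
  obtain ⟨e, he⟩ := hB0
  obtain ⟨μ, hμ, hμ1, hsum⟩ := hlarge
  have hΛ : ‖diagMap lam‖ ≤ 1 := hstable.norm_diagMap_lt_one.le
  set L : Fin N → (Fin d → ℝ) →L[ℝ] (Fin d → ℝ) := fun i =>
    -((e.symm : (Fin d → ℝ) →L[ℝ] (Fin d → ℝ)).comp (B Z i.succ)) with hLdef
  have hL : ∑ i : Fin N, (‖diagMap lam‖ ^ r) ^ ((i : ℕ) + 1) * ‖L i‖ < 1 := by
    refine lt_of_le_of_lt (Finset.sum_le_sum fun i _ => ?_) hsum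
    rw [← he, ContinuousLinearMap.inverse_equiv, hLdef, norm_neg]
    gcongr
  -- The nonlinear part `B₀⁻¹ (DZ(0) - Z)` is cut off to a global map, unchanged on the ball of
  -- radius `τ`.
  obtain ⟨g, τ, hτ, hg, hτU, hgτ⟩ := exists_contDiff_eqOn_ball hU h0U
    (f := fun θ => e.symm (fderiv ℝ Z 0 θ - Z θ))
    (e.symm.contDiff.comp_contDiffOn ((fderiv ℝ Z 0).contDiff.contDiffOn.sub hZ))
  have hg0 : g 0 = 0 := by
    rw [hgτ 0 (Metric.mem_ball_self hτ)]
    simp [hZ0]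
  have hg' : fderiv ℝ g 0 = 0 := by
    have hZd : HasFDerivAt Z (fderiv ℝ Z 0) 0 :=
      ((hZ.contDiffAt (hU.mem_nhds h0U)).differentiableAt (by simp)).hasFDerivAt
    have h1 : HasFDerivAt (𝕜 := ℝ) (fun θ => e.symm (fderiv ℝ Z 0 θ - Z θ)) 0 0 := by
      have h2 := (e.symm : (Fin d → ℝ) →L[ℝ] (Fin d → ℝ)).hasFDerivAt.comp 0
        ((fderiv ℝ Z 0).hasFDerivAt.sub hZd)
      rwa [sub_self, ContinuousLinearMap.comp_zero] at h2
    refine (h1.congr_of_eventuallyEq ?_).fderiv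
    filter_upwards [Metric.ball_mem_nhds _ hτ] with θ hθ using hgτ θ hθ
  have hsolve : ∀ n, 2 ≤ n → ∀ f : Fin n → Fin m, ∀ y : Fin d → ℝ, ∃ c : Fin d → ℝ,
      c - ∑ i : Fin N, (∏ j, lam (f j)) ^ ((i : ℕ) + 1) • L i c = y := by
    intro n hn f y
    obtain ⟨c, hc⟩ := hnonres.surjective_T hn f (e y)
    refine ⟨c, ?_⟩
    rw [← symm_T_apply he.symm, hc, e.symm_apply_apply]
  set A : (Fin m → ℝ) →L[ℝ] (Fin d → ℝ) :=
    LinearMap.toContinuousLinearMap (Fintype.linearCombination ℝ v) with hAdef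
  have hAapply : ∀ z, A z = ∑ i, z i • v i := fun z => Fintype.linearCombination_apply ℝ v z
  have hA : ∀ z, linearStep (diagMap lam) L A z = A z := by
    intro z
    have hvi : ∀ i, v i = ∑ k : Fin N, lam i ^ ((k : ℕ) + 1) • L k (v i) := by
      intro i
      have h := symm_T_apply he.symm (lam i) (v i)
      rw [(hv i).2, map_zero] at h
      exact sub_eq_zero.1 h.symm
    simp only [linearStep, hAapply, diagMap_pow_apply, map_sum, map_smul]
    rw [Finset.sum_comm]
    refine Finset.sum_congr rfl fun i _ => ?_
    conv_rhs => rw [hvi i, Finset.smul_sum]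
    refine Finset.sum_congr rfl fun k _ => ?_
    rw [smul_smul, mul_comm]
  obtain ⟨P₀, hP₀, hP₀0, hP₀', hjet⟩ := exists_contDiff_jet hsolve hg hg0 hg' A hA hr le_rfl
  -- With `η = τ`, the orbit of `P` stays where `g` is the original nonlinear part.
  obtain ⟨ρ, hρ, P, hP, hP0, heq, hPτ, hP'⟩ :=
    exists_contDiffOn_eq_step hr hΛ hL hg hg0 hg' hP₀ hP₀0 hjet hτ
  rw [hP₀'] at hP'
  refine ⟨ρ, hρ, P, hP, hP0, fun z hz => ?_, fun i => ?_, ?_⟩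
  · have hmem : orbitTuple N lam P z ∈ Metric.ball (0 : Fin (N + 1) → Fin d → ℝ) τ := by
      rw [mem_ball_zero_iff, pi_norm_lt_iff hτ]
      exact fun j => hPτ _ (pow_mem_ball hΛ _ hz)
    refine ⟨hτU hmem, ?_⟩
    have h1 := heq z hz
    have h2 : step (diagMap lam) L g P z =
        linearStep (diagMap lam) L P z + g (orbitTuple N lam P z) := rfl
    have h3 : orbitTuple N lam P z 0 = P z := by simp [orbitTuple]
    have h4 : linearStep (diagMap lam) L P z = ∑ i, L i (orbitTuple N lam P z i.succ) := by
      simp [linearStep, orbitTuple]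
    rw [h2, hgτ _ hmem, map_sub, symm_fderiv_apply he.symm, h3, h4] at h1
    have h5 : e.symm (Z (orbitTuple N lam P z)) = 0 := by
      linear_combination h1
    simpa using h5
  · rw [hP', hAapply]
    simp [Pi.single_apply]
  · rw [hP', hAdef]
    exact Fintype.range_linearCombination ℝ v
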